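/- Let $r\ge 2$ be even, let $m\ge 3$ be odd, put $n=2^m-1$, and let $\alpha$ be a generator of $\mathbb{F}_{2^m}^*$. For $S\subseteq\mathbb{Z}_r$ let $T_{[r,m,S]}=\{1\le j\le n-1 : w_2(j) \bmod r\in S\}$, where $w_2(j)$ is the number of ones in the binary expansion of $j$, and let $\mathcal{C}_{[r,m,S]}$ be the binary cyclic code of length $n$ with generator polynomial $\prod_{i\in T_{[r,m,S]}}(x-\alpha^i)$. Let $t\neq 3$ be an odd integer with $m\equiv t\pmod r$. Let $S\subset\mathbb{Z}_r$ with $|S|=r/2$, and suppose that the complement $S'=\mathbb{Z}_r\setminus S$ satisfies $S'=\{t-i : i\in S\}$. Suppose that $S$ contains (the residues modulo $r$ of) $\frac{t-1}{2},\frac{t+r+1}{2},t-1$, or contains $\frac{t+1}{2},\frac{t+r-1}{2},1$. Then the following hold. (1) $\mathcal{C}_{[r,m,S]}$ and $\mathcal{C}_{[r,m,S']}$ form a pair of odd-like duadic codes with parameters $[2^m-1,2^{m-1},d]$, where $d\ge 2^{(m-1)/2}+3$ if $m\equiv t\pmod{2r}$, and $d\ge 2^{(m-1)/2}+1$ if $m\equiv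 t+r\pmod{2r}$. (2) The dual codes $\mathcal{C}_{[r,m,S]}^{\perp}$ and $\mathcal{C}_{[r,m,S']}^{\perp}$ form a pair of even-like duadic codes with parameters $[2^m-1,2^{m-1}-1,d^{\perp}]$, where $d^{\perp}\ge 2^{(m-1)/2}+4$ if $m\equiv t\pmod{2r}$, and $d^{\perp}\ge 2^{(m-1)/2}+2$ if $m\equiv t+r\pmod{2r}$. (3) The extended codes $\overline{\mathcal{C}_{[r,m,S]}}$ and $\overline{\mathcal{C}_{[r,m,S']}}$ (obtained by appending an overall parity check coordinate) have parameters $[2^m,2^{m-1},\overline{d}]$, with $\overline{d}\ge 2^{(m-1)/2}+4$ if $m\ge 5$. Moreover, they are self-dual and doubly-even. Here a pair of binary cyclic codes of length $n$ is odd-like duadic if their defining sets with respect to $\alpha$ are $S_1,S_2$, and even-like duadic if they are $\{0\}\cup S_1,\{0\}\cup S_2$, where $S_1,S_2$ are unions of $2$-cyclotomic cosets that partition $\mathbb{Z}_n\setminus\{0\}$ and there is a unit $\mu\in\mathbb{Z}_n$ with $\mu S_1=S_2$ and $\mu S_2=S_1$. -/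

import Mathlib

open Polynomial

/-- The polynomial `c_0 + c_1 X + ⋯ + c_{n-1} X^{n-1}` of a binary word of length `n`. -/
noncomputable def wordPoly {n : ℕ} (c : Fin n → ZMod 2) : (ZMod 2)[X] :=
  ∑ i : Fin n, C (c i) * X ^ (i : ℕ)

/-- The minimum distance of a binary linear code. -/
noncomputable def minDist {ι : Type*} [Fintype ι] (K : Submodule (ZMod 2) (ι → ZMod 2)) : ℕ :=
  sInf {d : ℕ | ∃ x ∈ K, ∃ y ∈ K, x ≠ y ∧ hammingDist x y = d}

/-- `K` is a binary linear code with parameters `[n, k, d]`. -/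
def HasParameters {ι : Type*} [Fintype ι] (K : Submodule (ZMod 2) (ι → ZMod 2))
    (n k d : ℕ) : Prop :=
  Fintype.card ι = n ∧ Module.finrank (ZMod 2) K = k ∧ minDist K = d

/-- The Euclidean dual of a binary linear code. -/
def dualCode {ι : Type*} [Fintype ι] (K : Submodule (ZMod 2) (ι → ZMod 2)) :
    Submodule (ZMod 2) (ι → ZMod 2) where
  carrier := {y | ∀ x ∈ K, ∑ i, x i * y i = 0}
  zero_mem' := by
    intro x _
    simp
  add_mem' := by
    intro a b ha hb x hx
    simp only [Pi.add_apply, mul_add, Finset.sum_add_distrib]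
    rw [ha x hx, hb x hx, add_zero]
  smul_mem' := by
    intro k a ha x hx
    simp only [Pi.smul_apply, smul_eq_mul, mul_left_comm _ k]
    rw [← Finset.mul_sum, ha x hx, mul_zero]

/-- A code is self-dual if it equals its Euclidean dual. -/
def IsSelfDual {ι : Type*} [Fintype ι] (K : Submodule (ZMod 2) (ι → ZMod 2)) : Prop :=
  dualCode K = K

/-- A code is doubly-even if all its weights are divisible by four. -/
def IsDoublyEven {ι : Type*} [Fintype ι] (K : Submodule (ZMod 2) (ι → ZMod 2)) : Prop :=
  ∀ c ∈ K, 4 ∣ hammingNorm c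

/-- The extended code: the words `(c_0, …, c_n)` with `(c_0, …, c_{n-1})` in the code
and `c_0 + ⋯ + c_n = 0`. -/
def extendedCode {n : ℕ} (K : Submodule (ZMod 2) (Fin n → ZMod 2)) :
    Submodule (ZMod 2) (Fin (n + 1) → ZMod 2) where
  carrier := {c | (fun i : Fin n => c i.castSucc) ∈ K ∧ ∑ i, c i = 0}
  zero_mem' := ⟨K.zero_mem, by simp⟩
  add_mem' := by
    intro a b ha hb
    refine ⟨K.add_mem ha.1 hb.1, ?_⟩
    simp only [Pi.add_apply, Finset.sum_add_distrib]
    rw [ha.2, hb.2, add_zero]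
  smul_mem' := by
    intro k a ha
    refine ⟨K.smul_mem k ha.1, ?_⟩
    simp only [Pi.smul_apply, smul_eq_mul]
    rw [← Finset.mul_sum, ha.2, mul_zero]

/-- `K` is the binary cyclic code of length `n` with generator polynomial `g`, that is,
`g` is a monic divisor of `X ^ n - 1` and the words of `K` are the multiples of `g`. -/
def IsGeneratorPolynomial {n : ℕ} (K : Submodule (ZMod 2) (Fin n → ZMod 2))
    (g : (ZMod 2)[X]) : Prop :=
  g.Monic ∧ g ∣ X ^ n - 1 ∧ ∀ c : Fin n → ZMod 2, c ∈ K ↔ g ∣ wordPoly c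

/-- `K` is a binary cyclic code of length `n` with defining set `T` with respect to `α`
(an element of multiplicative order `n`). -/
def HasDefiningSet {F : Type*} [Field F] [Algebra (ZMod 2) F] {n : ℕ} (α : F)
    (K : Submodule (ZMod 2) (Fin n → ZMod 2)) (T : Set (ZMod n)) : Prop :=
  ∃ g : (ZMod 2)[X], IsGeneratorPolynomial K g ∧
    T = {i : ZMod n | aeval (α ^ i.val) g = 0}

/-- `(S₁, S₂, μ)` is a splitting of `ZMod n`; being closed under doubling means being
a union of 2-cyclotomic cosets. -/
def IsSplitting {n : ℕ} (S₁ S₂ : Set (ZMod n)) (μ : (ZMod n)ˣ) : Prop :=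
  (∀ s ∈ S₁, 2 * s ∈ S₁) ∧ (∀ s ∈ S₂, 2 * s ∈ S₂) ∧
  S₁ ∪ S₂ = {0}ᶜ ∧ S₁ ∩ S₂ = ∅ ∧
  (fun s => s * (μ : ZMod n)) '' S₁ = S₂ ∧ (fun s => s * (μ : ZMod n)) '' S₂ = S₁

/-- A pair of binary odd-like duadic codes of length `n`. -/
def IsOddLikeDuadicPair {F : Type*} [Field F] [Algebra (ZMod 2) F] {n : ℕ} (α : F)
    (K₁ K₂ : Submodule (ZMod 2) (Fin n → ZMod 2)) : Prop :=
  ∃ (S₁ S₂ : Set (ZMod n)) (μ : (ZMod n)ˣ), IsSplitting S₁ S₂ μ ∧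
    HasDefiningSet α K₁ S₁ ∧ HasDefiningSet α K₂ S₂

/-- A pair of binary even-like duadic codes of length `n`. -/
def IsEvenLikeDuadicPair {F : Type*} [Field F] [Algebra (ZMod 2) F] {n : ℕ} (α : F)
    (K₁ K₂ : Submodule (ZMod 2) (Fin n → ZMod 2)) : Prop :=
  ∃ (S₁ S₂ : Set (ZMod n)) (μ : (ZMod n)ˣ), IsSplitting S₁ S₂ μ ∧
    HasDefiningSet α K₁ ({0} ∪ S₁) ∧ HasDefiningSet α K₂ ({0} ∪ S₂)

/-- The number of ones in the binary expansion of `j`. -/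
def binaryWeight (j : ℕ) : ℕ := (Nat.digits 2 j).sum

/-- The set of all `j` with `1 ≤ j ≤ 2 ^ m - 2` whose binary weight modulo `r` is in `S`. -/
def weightSet (r m : ℕ) (S : Finset (ZMod r)) : Finset ℕ :=
  (Finset.Icc 1 (2 ^ m - 2)).filter fun j => ((binaryWeight j : ℕ) : ZMod r) ∈ S

/-- The product of all `X - α ^ i` for `i` in `weightSet r m S`. -/
noncomputable def weightGenPoly {F : Type*} [Field F] (r m : ℕ) (S : Finset (ZMod r))
    (α : F) : F[X] :=
  ∏ i ∈ weightSet r m S, (X - C (α ^ i))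

/-- The binary cyclic code of length `2 ^ m - 1` with generator polynomial
`weightGenPoly r m S α`: the binary words whose polynomial is a multiple of it.
(For `α` of order `2 ^ m - 1` the generator has coefficients in the prime field, so that
divisibility over the extension field is the same as over the prime field.) -/
def weightCode {F : Type*} [Field F] [Algebra (ZMod 2) F] (r m : ℕ) (S : Finset (ZMod r))
    (α : F) : Submodule (ZMod 2) (Fin (2 ^ m - 1) → ZMod 2) where
  carrier := {c | weightGenPoly r m S α ∣ (wordPoly c).map (algebraMap (ZMod 2) F)}
  zero_mem' := by simp [wordPoly]
  add_mem' := by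
    intro a b ha hb
    have h : wordPoly (a + b) = wordPoly a + wordPoly b := by
      simp [wordPoly, add_mul, Finset.sum_add_distrib]
    simp only [Set.mem_ofPred_eq, h, Polynomial.map_add] at *
    exact dvd_add ha hb
  smul_mem' := by
    intro k a ha
    have h : wordPoly (k • a) = C k * wordPoly a := by
      simp [wordPoly, Finset.mul_sum, mul_assoc]
    simp only [Set.mem_ofPred_eq, h, Polynomial.map_mul] at *
    exact dvd_mul_of_dvd_right ha _

/-! Write m = 2h + 1 and n = 2^m - 1. Replacing j by n - j flips all m bits, so w(n - j) = m - w(j),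
and as m = t modulo r the pairing condition says exactly that negation exchanges the defining sets T
and T' of the two codes. Doubling modulo n rotates the m bits, so T and T' are unions of cyclotomic
cosets. This gives the splitting with μ = -1 and the dimensions.

Since T and -T partition the nonzero residues, a discrete Parseval identity leaves only the term at
1: two words of the code have inner product equal to the product of their parities
(`sum_mul_eq_of_mem_zeroCode`). Hence the dual is the even-weight subcode (`dualCode_zeroCode`) and
the extended code is self-dual. An even-weight word is orthogonal to its cyclic shifts, which forces
4 to divide its weight (`four_dvd_hammingNorm_of_orthogonal_shifts`); adding the all-one word
settles the odd words in the extension.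

For the distances, the BCH bound is applied to β = α^(2^h - 1), still primitive because gcd(h, 2h +
1) = 1. The multiples k(2^h - 1) have binary weight h for 1 ≤ k ≤ 2^h, then 2h and h for the next
two k. The residue conditions put h, and also 2h when m = t modulo 2r, in S or in its complement
(`exists_mem_of_residue_conditions`). Reversing coordinates carries one code to the other, so it
does not matter which. The even-like codes gain the zero at exponent 0, and divisibility by 4
improves the bound for the extended codes. -/

/-! ### Binary linear codes: duals, minimum distance, coordinate permutations -/

section GeneralCodes

variable {ι κ : Type*} [Fintype ι] [Fintype κ]

theorem mem_dualCode {K : Submodule (ZMod 2) (ι → ZMod 2)} {y : ι → ZMod 2} :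
    y ∈ dualCode K ↔ ∀ x ∈ K, ∑ i, x i * y i = 0 := Iff.rfl

/-- The dot product identifies the dual code with the annihilator of `K` in the dual space. -/
theorem finrank_dualCode_add_finrank (K : Submodule (ZMod 2) (ι → ZMod 2)) :
    Module.finrank (ZMod 2) (dualCode K) + Module.finrank (ZMod 2) K = Fintype.card ι := by
  classical
  have h : (dualCode K).map (dotProductEquiv (ZMod 2) ι).toLinearMap = K.dualAnnihilator := by
    ext f
    obtain ⟨y, rfl⟩ := (dotProductEquiv (ZMod 2) ι).surjective f
    rw [Submodule.mem_dualAnnihilator]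
    simp only [Submodule.mem_map, LinearEquiv.coe_coe, EmbeddingLike.apply_eq_iff_eq,
      exists_eq_right, mem_dualCode, dotProductEquiv_apply_apply, dotProduct]
    simp only [mul_comm]
  have h2 := Subspace.finrank_add_finrank_dualAnnihilator_eq K
  rw [← h, LinearEquiv.finrank_map_eq, Module.finrank_fintype_fun_eq_card] at h2
  omega

/-- Linearity turns distances into weights. Positive dimension is needed because `sInf ∅ = 0`. -/
theorem le_minDist {K : Submodule (ZMod 2) (ι → ZMod 2)} {b : ℕ}
    (hK : 0 < Module.finrank (ZMod 2) K)
    (h : ∀ c ∈ K, c ≠ 0 → b ≤ hammingNorm c) : b ≤ minDist K := by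
  have hne : {d : ℕ | ∃ x ∈ K, ∃ y ∈ K, x ≠ y ∧ hammingDist x y = d}.Nonempty := by
    have hb : K ≠ ⊥ := by
      rintro rfl
      simp at hK
    obtain ⟨x, hx, hx0⟩ := Submodule.exists_mem_ne_zero_of_ne_bot hb
    exact ⟨_, x, hx, 0, K.zero_mem, hx0, rfl⟩
  obtain ⟨x, hx, y, hy, hxy, hd⟩ := Nat.sInf_mem hne
  change b ≤ sInf _
  rw [← hd, hammingDist_eq_hammingNorm]
  refine h _ ?_ ?_
  · exact K.add_mem (K.neg_mem hx) hy
  · intro h0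
    exact hxy (neg_add_eq_zero.mp h0)

theorem hammingDist_comp_equiv (σ : ι ≃ κ) (x y : κ → ZMod 2) :
    hammingDist (x ∘ σ) (y ∘ σ) = hammingDist x y := by
  unfold hammingDist
  refine Finset.card_equiv σ ?_
  simp

theorem minDist_eq_of_equiv (σ : ι ≃ κ) {K : Submodule (ZMod 2) (ι → ZMod 2)}
    {K' : Submodule (ZMod 2) (κ → ZMod 2)} (h : ∀ c, c ∈ K' ↔ c ∘ σ ∈ K) :
    minDist K' = minDist K := by
  unfold minDist
  congr 1
  ext d
  constructor
  · rintro ⟨x, hx, y, hy, hxy, hd⟩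
    refine ⟨x ∘ σ, (h x).1 hx, y ∘ σ, (h y).1 hy, ?_, ?_⟩
    · intro he
      exact hxy (σ.surjective.injective_comp_right he)
    · rw [hammingDist_comp_equiv, hd]
  · rintro ⟨x, hx, y, hy, hxy, hd⟩
    have e : ∀ z : ι → ZMod 2, (z ∘ σ.symm) ∘ σ = z := fun z => by ext; simp
    refine ⟨x ∘ σ.symm, (h _).2 (by rwa [e]), y ∘ σ.symm, (h _).2 (by rwa [e]), ?_, ?_⟩
    · intro he
      exact hxy (σ.symm.surjective.injective_comp_right he)
    · rw [hammingDist_comp_equiv, hd]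

theorem mem_dualCode_iff_of_equiv (σ : ι ≃ κ) {K : Submodule (ZMod 2) (ι → ZMod 2)}
    {K' : Submodule (ZMod 2) (κ → ZMod 2)} (h : ∀ c, c ∈ K' ↔ c ∘ σ ∈ K) (c : κ → ZMod 2) :
    c ∈ dualCode K' ↔ c ∘ σ ∈ dualCode K := by
  simp only [mem_dualCode]
  constructor
  · intro hc x hx
    have e : (x ∘ σ.symm) ∘ σ = x := by ext; simp
    rw [← hc (x ∘ σ.symm) ((h _).2 (by rwa [e])), ← σ.sum_comp]
    simp
  · intro hc x hx
    rw [← hc (x ∘ σ) ((h _).1 hx), ← σ.sum_comp]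
    rfl

theorem isSelfDual_of_orthogonal {K : Submodule (ZMod 2) (ι → ZMod 2)}
    (hK : ∀ x ∈ K, ∀ y ∈ K, ∑ i, x i * y i = 0)
    (hd : 2 * Module.finrank (ZMod 2) K = Fintype.card ι) : IsSelfDual K := by
  have h := finrank_dualCode_add_finrank K
  have hle : K ≤ dualCode K := fun y hy x hx => hK x hx y hy
  exact (Submodule.eq_of_le_of_finrank_eq hle (by omega)).symm

theorem ZMod.eq_zero_or_one_of_two (a : ZMod 2) : a = 0 ∨ a = 1 := by
  revert a
  decide

theorem hammingNorm_add_hammingNorm_add_one (c : ι → ZMod 2) :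
    hammingNorm c + hammingNorm (c + 1) = Fintype.card ι := by
  classical
  unfold hammingNorm
  have : ∀ i, (c + 1) i ≠ 0 ↔ ¬ c i ≠ 0 := by
    intro i
    rcases ZMod.eq_zero_or_one_of_two (c i) with h | h <;> simp [h, CharTwo.add_self_eq_zero]
  simp only [this]
  exact Finset.card_filter_add_card_filter_not _

theorem natCast_hammingNorm (c : ι → ZMod 2) : ((hammingNorm c : ℕ) : ZMod 2) = ∑ i, c i := by
  classical
  unfold hammingNorm
  rw [Finset.card_filter]
  push_cast
  refine Finset.sum_congr rfl fun i _ => ?_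
  rcases ZMod.eq_zero_or_one_of_two (c i) with h | h <;> simp [h]

end GeneralCodes

/-! ### Extension by a parity check -/

section Extension

variable {n : ℕ} {K K' : Submodule (ZMod 2) (Fin n → ZMod 2)}

theorem mem_extendedCode {c : Fin (n + 1) → ZMod 2} :
    c ∈ extendedCode K ↔ (fun i : Fin n => c i.castSucc) ∈ K ∧ ∑ i, c i = 0 := Iff.rfl

theorem extendedCode_last {c : Fin (n + 1) → ZMod 2} (hc : c ∈ extendedCode K) :
    c (Fin.last n) = ∑ i : Fin n, c i.castSucc := by
  have h := hc.2
  rw [Fin.sum_univ_castSucc] at h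
  rw [eq_comm, ← sub_eq_zero, sub_eq_add_neg, ZMod.neg_eq_self_mod_two]
  exact h

theorem finrank_extendedCode (K : Submodule (ZMod 2) (Fin n → ZMod 2)) :
    Module.finrank (ZMod 2) (extendedCode K) = Module.finrank (ZMod 2) K := by
  let f : extendedCode K →ₗ[ZMod 2] K :=
    { toFun := fun c => ⟨fun i => c.1 i.castSucc, c.2.1⟩
      map_add' := fun _ _ => rfl
      map_smul' := fun _ _ => rfl }
  refine (LinearEquiv.ofBijective f ⟨?_, ?_⟩).finrank_eq
  · intro x y h
    have h' : ∀ i : Fin n, x.1 i.castSucc = y.1 i.castSucc := fun i =>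
      congrFun (congrArg Subtype.val h) i
    ext i
    refine Fin.lastCases ?_ h' i
    rw [extendedCode_last x.2, extendedCode_last y.2]
    simp only [h']
  · intro x
    refine ⟨⟨Fin.snoc x.1 (∑ i, x.1 i), ?_, ?_⟩, ?_⟩
    · simp
    · rw [Fin.sum_univ_castSucc]
      simp [CharTwo.add_self_eq_zero]
    · ext i
      simp [f]

theorem hammingNorm_extended (c : Fin (n + 1) → ZMod 2) :
    hammingNorm c = hammingNorm (fun i : Fin n => c i.castSucc) +
      if c (Fin.last n) = 0 then 0 else 1 := by
  classical
  unfold hammingNorm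
  rw [Finset.card_filter, Finset.card_filter, Fin.sum_univ_castSucc]
  simp only [ne_eq, ite_not]

theorem minDist_extendedCode_eq_of_equiv (σ : Fin n ≃ Fin n) (h : ∀ c, c ∈ K' ↔ c ∘ σ ∈ K) :
    minDist (extendedCode K') = minDist (extendedCode K) := by
  -- The permutation acting as `σ` on the first `n` coordinates and fixing the parity coordinate.
  let τ : Fin (n + 1) ≃ Fin (n + 1) :=
    (finSuccEquivLast.trans (Equiv.optionCongr σ)).trans finSuccEquivLast.symm
  refine minDist_eq_of_equiv τ fun c => ?_
  have hτ : ∀ i : Fin n, τ i.castSucc = (σ i).castSucc := fun i => by simp [τ]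
  rw [mem_extendedCode, mem_extendedCode, h]
  have hs : ∑ i, (c ∘ τ) i = ∑ i, c i := τ.sum_comp c
  rw [hs]
  simp only [Function.comp_apply, hτ]
  rfl

/-- A word with parity bit 1 becomes one with parity bit 0 on adding the all-one word, which
replaces its weight w by n + 1 - w. -/
theorem isDoublyEven_extendedCode (hn : 4 ∣ n + 1) (h1 : (1 : Fin n → ZMod 2) ∈ K)
    (hK : ∀ c ∈ K, ∑ i, c i = 0 → 4 ∣ hammingNorm c) : IsDoublyEven (extendedCode K) := by
  have key : ∀ c ∈ extendedCode K, c (Fin.last n) = 0 → 4 ∣ hammingNorm c := by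
    intro c hc h0
    rw [hammingNorm_extended, if_pos h0]
    exact hK _ hc.1 (by rw [← extendedCode_last hc, h0])
  intro c hc
  rcases ZMod.eq_zero_or_one_of_two (c (Fin.last n)) with h0 | h0
  · exact key c hc h0
  · have hone : (1 : Fin (n + 1) → ZMod 2) ∈ extendedCode K := by
      refine ⟨h1, ?_⟩
      obtain ⟨k, hk⟩ := hn
      have : ((4 : ℕ) : ZMod 2) = 0 := by decide
      simp only [Pi.one_apply, Finset.sum_const, Finset.card_univ, Fintype.card_fin, nsmul_one]
      rw [hk, Nat.cast_mul, this, zero_mul]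
    have h2 := key _ ((extendedCode K).add_mem hc hone) (by simp [h0, CharTwo.add_self_eq_zero])
    have h3 := hammingNorm_add_hammingNorm_add_one c
    rw [Fintype.card_fin] at h3
    rw [← h3] at hn
    exact (Nat.dvd_add_left h2).1 hn

end Extension

/-! ### Words as polynomials; dimension from a generator polynomial -/

section WordPoly

variable {n : ℕ}

theorem wordPoly_coeff_of_degree_lt {p : (ZMod 2)[X]} (hp : p.degree < n) :
    wordPoly (fun i : Fin n => p.coeff i) = p := by
  unfold wordPoly
  rw [Fin.sum_univ_eq_sum_range (fun i => C (p.coeff i) * X ^ i) n]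
  rcases eq_or_ne p 0 with rfl | h
  · simp
  · exact (p.as_sum_range_C_mul_X_pow' ((natDegree_lt_iff_degree_lt h).2 hp)).symm

theorem degree_wordPoly_lt (c : Fin n → ZMod 2) : (wordPoly c).degree < n := by
  unfold wordPoly
  refine (degree_sum_le _ _).trans_lt ((Finset.sup_lt_iff (WithBot.bot_lt_coe n)).2 fun i _ => ?_)
  exact (degree_C_mul_X_pow_le _ _).trans_lt (Nat.cast_lt.2 i.2)

theorem wordPoly_coeff (c : Fin n → ZMod 2) (i : Fin n) : (wordPoly c).coeff i = c i := by
  simp [wordPoly, finsetSum_coeff, coeff_C_mul, coeff_X_pow, Fin.val_inj]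

theorem finrank_of_isGeneratorPolynomial {K : Submodule (ZMod 2) (Fin n → ZMod 2)}
    {g : (ZMod 2)[X]} (h : IsGeneratorPolynomial K g) (hg : g.natDegree ≤ n) :
    Module.finrank (ZMod 2) K = n - g.natDegree := by
  obtain ⟨hm, -, hK⟩ := h
  set d := g.natDegree with hd
  -- Multiplication by `g`, truncated to `n` coefficients; on degrees below `n - d` the truncation
  -- loses nothing, so `f` is injective there with image `K`.
  let f : (ZMod 2)[X] →ₗ[ZMod 2] (Fin n → ZMod 2) :=
    { toFun := fun p i => (g * p).coeff i
      map_add' := fun p q => by ext; simp [mul_add]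
      map_smul' := fun a p => by ext; simp }
  have hdeg : ∀ p ∈ degreeLT (ZMod 2) (n - d), (g * p).degree < n := by
    intro p hp
    rw [mem_degreeLT] at hp
    rcases eq_or_ne p 0 with rfl | h0
    · simp
    · rw [← natDegree_lt_iff_degree_lt h0] at hp
      rw [← natDegree_lt_iff_degree_lt (mul_ne_zero hm.ne_zero h0),
        natDegree_mul hm.ne_zero h0]
      omega
  have hmap : K = (degreeLT (ZMod 2) (n - d)).map f := by
    ext c
    rw [hK, Submodule.mem_map]
    constructor
    · rintro ⟨p, hp⟩
      refine ⟨p, ?_, ?_⟩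
      · rw [mem_degreeLT]
        rcases eq_or_ne p 0 with rfl | h0
        · simp
        · have := degree_wordPoly_lt c
          rw [hp, ← natDegree_lt_iff_degree_lt (mul_ne_zero hm.ne_zero h0),
            natDegree_mul hm.ne_zero h0] at this
          rw [← natDegree_lt_iff_degree_lt h0]
          omega
      · ext i
        change (g * p).coeff i = _
        rw [← hp, wordPoly_coeff]
    · rintro ⟨p, hp, rfl⟩
      exact ⟨p, wordPoly_coeff_of_degree_lt (hdeg p hp)⟩
  have hinj : Function.Injective (f.domRestrict (degreeLT (ZMod 2) (n - d))) := by
    rw [← LinearMap.ker_eq_bot, LinearMap.ker_eq_bot']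
    rintro ⟨p, hp⟩ h0
    have h1 := wordPoly_coeff_of_degree_lt (hdeg p hp)
    have h2 : (fun i : Fin n => (g * p).coeff i) = 0 := h0
    rw [h2] at h1
    have h3 : g * p = 0 := by rw [← h1]; simp [wordPoly]
    exact Subtype.ext ((mul_eq_zero.1 h3).resolve_left hm.ne_zero)
  rw [hmap, ← LinearMap.range_domRestrict, LinearMap.finrank_range_of_inj hinj,
    (degreeLTEquiv (ZMod 2) (n - d)).finrank_eq, Module.finrank_fin_fun]

end WordPoly

/-! ### Powers of a primitive root, with exponents in `ZMod n` -/

section PrimitiveRoots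

variable {F : Type*} [Field F] {n : ℕ}

theorem prod_X_sub_C_dvd_iff {ι : Type*} {T : Finset ι} {f : ι → F} (hf : Set.InjOn f T)
    (p : F[X]) : ∏ i ∈ T, (X - C (f i)) ∣ p ↔ ∀ i ∈ T, p.eval (f i) = 0 := by
  constructor
  · intro h i hi
    have h1 : X - C (f i) ∣ ∏ i ∈ T, (X - C (f i)) := Finset.dvd_prod_of_mem _ hi
    exact dvd_iff_isRoot.1 (h1.trans h)
  · intro h
    refine Finset.prod_dvd_of_coprime ?_ fun i hi => dvd_iff_isRoot.2 (h i hi)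
    intro i hi j hj hij
    exact isCoprime_X_sub_C_of_isUnit_sub
      (sub_ne_zero.2 fun e => hij (hf hi hj e)).isUnit

theorem IsPrimitiveRoot.pow_mod_eq {a : F} (ha : IsPrimitiveRoot a n) (k : ℕ) :
    a ^ (k % n) = a ^ k := by
  conv_lhs => rw [ha.eq_orderOf]
  exact pow_mod_orderOf _ _

theorem IsPrimitiveRoot.pow_val_natCast {a : F} (ha : IsPrimitiveRoot a n) (k : ℕ) :
    a ^ ((k : ZMod n).val) = a ^ k := by
  rw [ZMod.val_natCast, ha.pow_mod_eq]

theorem IsPrimitiveRoot.pow_val_pow_eq_one {a : F} (ha : IsPrimitiveRoot a n) (k : ℕ) :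
    (a ^ k) ^ n = 1 := by
  rw [← pow_mul, mul_comm, pow_mul, ha.pow_eq_one, one_pow]

theorem ZMod.two_mul_injective_of_odd (hn : Odd n) :
    Function.Injective fun i : ZMod n => 2 * i := by
  have h : IsUnit ((2 : ℕ) : ZMod n) :=
    (ZMod.isUnit_iff_coprime 2 n).2 (Nat.coprime_two_left.2 hn)
  intro i j hij
  exact h.mul_left_cancel (by simpa using hij)

variable [NeZero n]

theorem IsPrimitiveRoot.pow_val_add {a : F} (ha : IsPrimitiveRoot a n) (i j : ZMod n) :
    a ^ (i + j).val = a ^ i.val * a ^ j.val := by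
  rw [ZMod.val_add, ha.pow_mod_eq, pow_add]

theorem IsPrimitiveRoot.pow_val_neg {a : F} (ha : IsPrimitiveRoot a n) (i : ZMod n) :
    a ^ (-i).val = (a ^ i.val)⁻¹ := by
  refine eq_inv_of_mul_eq_one_left ?_
  rw [← ha.pow_val_add, neg_add_cancel, ZMod.val_zero, pow_zero]

theorem IsPrimitiveRoot.pow_val_injective {a : F} (ha : IsPrimitiveRoot a n) :
    Function.Injective fun i : ZMod n => a ^ i.val := fun i j h =>
  ZMod.val_injective n (ha.pow_inj (ZMod.val_lt i) (ZMod.val_lt j) h)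

end PrimitiveRoots

/-! ### Cyclic codes given by zeros: BCH bound, orthogonality, reversal, shifts -/

section CyclicCodes

variable {F : Type*} [Field F] [Algebra (ZMod 2) F] {n : ℕ}

/-- The value at `β` of the polynomial of a binary word. -/
def wordEval (c : Fin n → ZMod 2) (β : F) : F :=
  ∑ i, algebraMap (ZMod 2) F (c i) * β ^ (i : ℕ)

theorem eval_map_wordPoly (c : Fin n → ZMod 2) (β : F) :
    ((wordPoly c).map (algebraMap (ZMod 2) F)).eval β = wordEval c β := by
  simp [wordPoly, wordEval, Polynomial.map_sum, eval_finsetSum]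

theorem wordEval_one (c : Fin n → ZMod 2) :
    wordEval c (1 : F) = algebraMap (ZMod 2) F (∑ i, c i) := by
  simp [wordEval]

/-- The binary words of length `n` whose polynomials vanish at `a ^ i` for `i ∈ T`. -/
def zeroCode (a : F) (T : Finset (ZMod n)) : Submodule (ZMod 2) (Fin n → ZMod 2) where
  carrier := {c | ∀ i ∈ T, wordEval c (a ^ i.val) = 0}
  zero_mem' := by simp [wordEval]
  add_mem' := by
    intro x y hx hy i hi
    have : wordEval (x + y) (a ^ i.val) = wordEval x (a ^ i.val) + wordEval y (a ^ i.val) := by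
      simp [wordEval, add_mul, Finset.sum_add_distrib]
    rw [this, hx i hi, hy i hi, add_zero]
  smul_mem' := by
    intro k x hx i hi
    have : wordEval (k • x) (a ^ i.val) = algebraMap (ZMod 2) F k * wordEval x (a ^ i.val) := by
      simp [wordEval, Finset.mul_sum, mul_assoc]
    rw [this, hx i hi, mul_zero]

theorem mem_zeroCode {a : F} {T : Finset (ZMod n)} {c : Fin n → ZMod 2} :
    c ∈ zeroCode a T ↔ ∀ i ∈ T, wordEval c (a ^ i.val) = 0 := Iff.rfl

variable [NeZero n]

/-- A product of linear factors over a union of 2-cyclotomic cosets is defined over the prime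
field. -/
theorem exists_map_eq_prod_X_sub_C {a : F} (ha : IsPrimitiveRoot a n) (hn : Odd n)
    {T : Finset (ZMod n)} (hT : ∀ i ∈ T, 2 * i ∈ T) :
    ∃ g : (ZMod 2)[X], g.map (algebraMap (ZMod 2) F) = ∏ i ∈ T, (X - C (a ^ i.val)) := by
  have : CharP F 2 := charP_of_injective_algebraMap (algebraMap (ZMod 2) F).injective 2
  -- Frobenius sends the factor of `i` to that of `2 * i`, hence permutes the factors; coefficients
  -- fixed by squaring are 0 or 1.
  have hfrob : (∏ i ∈ T, (X - C (a ^ i.val))).map (frobenius F 2) =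
      ∏ i ∈ T, (X - C (a ^ i.val)) := by
    rw [Polynomial.map_prod]
    have hinj : Set.InjOn (fun i : ZMod n => 2 * i) T :=
      (ZMod.two_mul_injective_of_odd hn).injOn
    refine Finset.prod_nbij (fun i => 2 * i) hT hinj
      (Finset.surjOn_of_injOn_of_card_le _ hT hinj le_rfl) fun i _ => ?_
    rw [two_mul, ha.pow_val_add, Polynomial.map_sub, map_X, map_C, frobenius_def, sq]
  refine (lifts_iff_coeff_lifts _).2 fun k => ?_
  have h := congrArg (fun p => p.coeff k) hfrob
  simp only [coeff_map, frobenius_def] at h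
  set x := (∏ i ∈ T, (X - C (a ^ i.val))).coeff k
  have h2 : x * (x - 1) = 0 := by
    rw [mul_sub, mul_one, ← sq, h, sub_self]
  rcases mul_eq_zero.1 h2 with h0 | h1
  · exact ⟨0, by rw [h0, map_zero]⟩
  · exact ⟨1, by rw [sub_eq_zero.1 h1, map_one]⟩

theorem exists_generatorPolynomial_zeroCode {a : F} (ha : IsPrimitiveRoot a n) (hn : Odd n)
    {T : Finset (ZMod n)} (hT : ∀ i ∈ T, 2 * i ∈ T) :
    ∃ g : (ZMod 2)[X], IsGeneratorPolynomial (zeroCode a T) g ∧ g.natDegree = T.card ∧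
      ∀ i : ZMod n, aeval (a ^ i.val) g = 0 ↔ i ∈ T := by
  obtain ⟨g, hg⟩ := exists_map_eq_prod_X_sub_C ha hn hT
  have hinj : Set.InjOn (fun i : ZMod n => a ^ i.val) T := ha.pow_val_injective.injOn
  refine ⟨g, ⟨?_, ?_, ?_⟩, ?_, ?_⟩
  · refine monic_of_injective (algebraMap (ZMod 2) F).injective ?_
    rw [hg]
    exact monic_prod_of_monic _ _ fun i _ => monic_X_sub_C _
  · rw [← map_dvd_map' (algebraMap (ZMod 2) F), hg, prod_X_sub_C_dvd_iff hinj]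
    intro i _
    simp [ha.pow_val_pow_eq_one]
  · intro c
    rw [← map_dvd_map' (algebraMap (ZMod 2) F), hg, prod_X_sub_C_dvd_iff hinj]
    simp only [eval_map_wordPoly]
    rfl
  · rw [← natDegree_map (algebraMap (ZMod 2) F), hg,
      natDegree_prod_of_monic _ _ fun i _ => monic_X_sub_C _]
    simp only [natDegree_X_sub_C, Finset.sum_const, smul_eq_mul, mul_one]
  · intro i
    rw [← eval_map_algebraMap, hg, eval_prod, Finset.prod_eq_zero_iff]
    constructor
    · rintro ⟨j, hj, h⟩
      rw [eval_sub, eval_X, eval_C, sub_eq_zero] at h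
      rwa [ha.pow_val_injective h]
    · intro hi
      exact ⟨i, hi, by simp⟩

theorem hasDefiningSet_zeroCode {a : F} (ha : IsPrimitiveRoot a n) (hn : Odd n)
    {T : Finset (ZMod n)} (hT : ∀ i ∈ T, 2 * i ∈ T) :
    HasDefiningSet a (zeroCode a T) (T : Set (ZMod n)) := by
  obtain ⟨g, hg, -, hz⟩ := exists_generatorPolynomial_zeroCode ha hn hT
  refine ⟨g, hg, ?_⟩
  ext i
  exact (hz i).symm

theorem finrank_zeroCode {a : F} (ha : IsPrimitiveRoot a n) (hn : Odd n)
    {T : Finset (ZMod n)} (hT : ∀ i ∈ T, 2 * i ∈ T) :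
    Module.finrank (ZMod 2) (zeroCode a T) = n - T.card := by
  obtain ⟨g, hg, hd, -⟩ := exists_generatorPolynomial_zeroCode ha hn hT
  rw [← hd]
  refine finrank_of_isGeneratorPolynomial hg ?_
  rw [hd]
  simpa [ZMod.card] using Finset.card_le_univ T

/-- The BCH bound. -/
theorem bch_bound {β : F} (hβ : IsPrimitiveRoot β n) {c : Fin n → ZMod 2} (hc : c ≠ 0) {b δ : ℕ}
    (h : ∀ k < δ, wordEval c (β ^ (b + k)) = 0) : δ + 1 ≤ hammingNorm c := by
  classical
  by_contra! hw
  obtain ⟨k₀, hk₀⟩ := Function.ne_iff.1 hc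
  set A : Finset (Fin n) := Finset.univ.filter fun i => c i ≠ 0 with hA
  have hk₀A : k₀ ∈ A := by simpa [hA] using hk₀
  have hAc : A.card = hammingNorm c := rfl
  -- If the weight were at most `δ`, `P` would have degree below `δ`. Combining the vanishing
  -- evaluations with the coefficients of `P` then isolates the single coordinate `k₀`.
  set P : F[X] := ∏ k ∈ A.erase k₀, (X - C (β ^ (k : ℕ))) with hP
  have hdeg : P.natDegree < δ := by
    rw [hP, natDegree_prod_of_monic _ _ fun i _ => monic_X_sub_C _]
    have h1 : 0 < A.card := Finset.card_pos.2 ⟨_, hk₀A⟩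
    simp only [natDegree_X_sub_C, Finset.sum_const, smul_eq_mul, mul_one,
      Finset.card_erase_of_mem hk₀A]
    omega
  have hsum : ∑ k : Fin n, algebraMap (ZMod 2) F (c k) * β ^ (b * k) * P.eval (β ^ (k : ℕ)) = 0 := by
    simp only [eval_eq_sum_range' hdeg, Finset.mul_sum]
    rw [Finset.sum_comm]
    refine Finset.sum_eq_zero fun l hl => ?_
    have h2 := congrArg (P.coeff l * ·) (h l (Finset.mem_range.1 hl))
    simp only [wordEval, Finset.mul_sum, mul_zero] at h2
    rw [← h2]
    refine Finset.sum_congr rfl fun k _ => ?_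
    rw [← pow_mul, ← pow_mul, add_mul, pow_add, mul_comm (k : ℕ) l]
    ring
  rw [Finset.sum_eq_single k₀ ?_ (by simp)] at hsum
  · have hβ0 : β ≠ 0 := hβ.ne_zero (NeZero.ne n)
    have hP0 : P.eval (β ^ (k₀ : ℕ)) ≠ 0 := by
      rw [hP, eval_prod, Finset.prod_ne_zero_iff]
      intro k hk
      rw [eval_sub, eval_X, eval_C, sub_ne_zero]
      intro e
      exact (Finset.mem_erase.1 hk).1 (Fin.ext (hβ.pow_inj k₀.2 k.2 e)).symm
    have hc0 : algebraMap (ZMod 2) F (c k₀) ≠ 0 := by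
      rwa [Ne, map_eq_zero]
    exact mul_ne_zero (mul_ne_zero hc0 (pow_ne_zero _ hβ0)) hP0 hsum
  · intro k _ hk
    by_cases hck : c k = 0
    · simp [hck]
    · have : P.eval (β ^ (k : ℕ)) = 0 := by
        rw [hP, eval_prod]
        refine Finset.prod_eq_zero (i := k) ?_ (by simp)
        simp [hA, hk, hck]
      rw [this, mul_zero]

/-- Parseval for the discrete Fourier transform: the off-diagonal terms are geometric sums of
nontrivial `n`-th roots of unity. -/
theorem sum_wordEval_mul_wordEval_inv {a : F} (ha : IsPrimitiveRoot a n) (x y : Fin n → ZMod 2) :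
    ∑ j ∈ Finset.range n, wordEval x (a ^ j) * wordEval y (a ^ j)⁻¹ =
      n * algebraMap (ZMod 2) F (∑ i, x i * y i) := by
  have ha0 : a ≠ 0 := ha.ne_zero (NeZero.ne n)
  simp only [wordEval, Finset.sum_mul_sum]
  rw [Finset.sum_comm, map_sum, Finset.mul_sum]
  refine Finset.sum_congr rfl fun i _ => ?_
  rw [Finset.sum_comm, Finset.sum_eq_single i ?_ (by simp)]
  · rw [Finset.sum_congr rfl (g := fun _ => algebraMap (ZMod 2) F (x i * y i))]
    · simp
    · intro j _
      rw [inv_pow, map_mul, mul_mul_mul_comm, mul_inv_cancel₀ (by positivity), mul_one]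
  · intro k _ hk
    have hζ1 : a ^ (i : ℕ) * (a ^ (k : ℕ))⁻¹ ≠ 1 := by
      rw [Ne, mul_inv_eq_one₀ (pow_ne_zero _ ha0)]
      intro e
      exact hk (Fin.ext (ha.pow_inj i.2 k.2 e)).symm
    have hζn : (a ^ (i : ℕ) * (a ^ (k : ℕ))⁻¹) ^ n = 1 := by
      rw [mul_pow, inv_pow, ha.pow_val_pow_eq_one, ha.pow_val_pow_eq_one, inv_one, one_mul]
    have hg := mul_geom_sum (a ^ (i : ℕ) * (a ^ (k : ℕ))⁻¹) n
    rw [hζn, sub_self] at hg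
    have hg' := (mul_eq_zero.1 hg).resolve_left (sub_ne_zero.2 hζ1)
    have e : ∀ j ∈ Finset.range n, algebraMap (ZMod 2) F (x i) * (a ^ j) ^ (i : ℕ) *
        (algebraMap (ZMod 2) F (y k) * (a ^ j)⁻¹ ^ (k : ℕ)) =
        algebraMap (ZMod 2) F (x i) * algebraMap (ZMod 2) F (y k) *
          (a ^ (i : ℕ) * (a ^ (k : ℕ))⁻¹) ^ j := by
      intro j _
      rw [mul_pow, inv_pow, inv_pow, ← pow_mul, ← pow_mul, ← pow_mul, ← pow_mul, mul_comm j,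
        mul_comm j]
      ring
    rw [Finset.sum_congr rfl e, ← Finset.mul_sum, hg', mul_zero]

/-- Only `j = 0` survives in the Parseval sum, and the factor `n` is 1 in characteristic 2. -/
theorem sum_mul_eq_of_forall_wordEval {a : F} (ha : IsPrimitiveRoot a n) (hn : Odd n)
    {x y : Fin n → ZMod 2}
    (h : ∀ j : ZMod n, j ≠ 0 → wordEval x (a ^ j.val) = 0 ∨ wordEval y (a ^ (-j).val) = 0) :
    ∑ i, x i * y i = (∑ i, x i) * ∑ i, y i := by
  have : CharP F 2 := charP_of_injective_algebraMap (algebraMap (ZMod 2) F).injective 2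
  have hP := sum_wordEval_mul_wordEval_inv ha x y
  have hn1 : (n : F) = 1 := by
    obtain ⟨k, rfl⟩ := hn
    push_cast
    rw [CharTwo.two_eq_zero, zero_mul, zero_add]
  rw [hn1, one_mul, Finset.sum_eq_single 0] at hP
  · apply (algebraMap (ZMod 2) F).injective
    rw [← hP, pow_zero, inv_one, wordEval_one, wordEval_one, map_mul]
  · intro j hj hj0
    have hjn := Finset.mem_range.1 hj
    have hne : (j : ZMod n) ≠ 0 := by
      rw [Ne, ZMod.natCast_eq_zero_iff]
      exact fun hd => absurd (Nat.le_of_dvd (by omega) hd) (by omega)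
    have := h j hne
    rw [ha.pow_val_neg, ha.pow_val_natCast] at this
    exact mul_eq_zero.2 this
  · intro h0
    exact absurd (Finset.mem_range.2 (NeZero.pos n)) h0

/-- The extra factor `β` corrects for `Fin.rev` being i ↦ n - 1 - i rather than i ↦ -i. -/
theorem mul_wordEval_comp_rev {β : F} (hβ : β ^ n = 1) (c : Fin n → ZMod 2) :
    β * wordEval (c ∘ Fin.rev) β = wordEval c β⁻¹ := by
  have hβ0 : β ≠ 0 := by
    rintro rfl
    rw [zero_pow (NeZero.ne n)] at hβ
    exact zero_ne_one hβ
  unfold wordEval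
  rw [← Equiv.sum_comp Fin.revPerm, Finset.mul_sum]
  refine Finset.sum_congr rfl fun i _ => ?_
  simp only [Fin.revPerm_apply, Function.comp_apply, Fin.rev_rev, Fin.val_rev, inv_pow]
  rw [mul_left_comm, ← pow_succ', show n - (i + 1) + 1 = n - i by omega]
  congr 1
  refine eq_inv_of_mul_eq_one_left ?_
  rw [← pow_add, Nat.sub_add_cancel i.2.le, hβ]

theorem comp_rev_mem_zeroCode_iff {a : F} (ha : IsPrimitiveRoot a n) {T T' : Finset (ZMod n)}
    (hT : ∀ i, i ∈ T' ↔ -i ∈ T) (c : Fin n → ZMod 2) :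
    c ∈ zeroCode a T' ↔ c ∘ Fin.revPerm ∈ zeroCode a T := by
  have key : ∀ i : ZMod n, wordEval (c ∘ Fin.revPerm) (a ^ (-i).val) = 0 ↔
      wordEval c (a ^ i.val) = 0 := by
    intro i
    have h := mul_wordEval_comp_rev (ha.pow_val_pow_eq_one (-i).val) c
    rw [← ha.pow_val_neg, neg_neg] at h
    rw [← h, mul_eq_zero, or_iff_right (pow_ne_zero _ (ha.ne_zero (NeZero.ne n)))]
    rfl
  simp only [mem_zeroCode]
  constructor
  · intro h i hi
    rw [← neg_neg i, key]
    exact h _ ((hT _).2 (by rwa [neg_neg]))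
  · intro h i hi
    rw [← key]
    exact h _ ((hT _).1 hi)

theorem wordEval_shift {β : F} (hβ : β ^ n = 1) (c : Fin n → ZMod 2) (s : Fin n) :
    wordEval (fun i => c (i - s)) β = β ^ (s : ℕ) * wordEval c β := by
  unfold wordEval
  rw [← Equiv.sum_comp (Equiv.addRight s), Finset.mul_sum]
  refine Finset.sum_congr rfl fun i _ => ?_
  simp only [Equiv.coe_addRight, add_sub_cancel_right, Fin.val_add]
  have : β ^ (((i : ℕ) + s) % n) = β ^ ((i : ℕ) + s) := by
    conv_rhs => rw [← Nat.mod_add_div ((i : ℕ) + s) n, pow_add, pow_mul, hβ, one_pow, mul_one]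
  rw [this, pow_add]
  ring

theorem one_mem_zeroCode {a : F} (ha : IsPrimitiveRoot a n) {T : Finset (ZMod n)} (hT : 0 ∉ T) :
    (1 : Fin n → ZMod 2) ∈ zeroCode a T := by
  intro i hi
  have hne : a ^ i.val ≠ 1 := by
    intro e
    have : i = 0 := ha.pow_val_injective (by simpa using e)
    exact hT (this ▸ hi)
  have hg := mul_geom_sum (a ^ i.val) n
  rw [ha.pow_val_pow_eq_one, sub_self] at hg
  have h1 := (mul_eq_zero.1 hg).resolve_left (sub_ne_zero.2 hne)
  simpa [wordEval, Fin.sum_univ_eq_sum_range (fun k => (a ^ i.val) ^ k) n] using h1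

/-- A binary word of even weight and odd length that is orthogonal to its cyclic shifts has
weight divisible by four. -/
theorem four_dvd_hammingNorm_of_orthogonal_shifts (hn : Odd n) {c : Fin n → ZMod 2}
    (hc : ∑ i, c i = 0) (h : ∀ s : Fin n, ∑ i, c i * c (i - s) = 0) : 4 ∣ hammingNorm c := by
  classical
  set A : Finset (Fin n) := Finset.univ.filter fun i => c i ≠ 0 with hA
  -- `N` is the autocorrelation of the support: its total is w², `N 0` is w, every value is even,
  -- and `N (-s) = N s`. Since `n` is odd, the nonzero shifts pair off as s, -s, so w² = w modulo 4;
  -- an even w is then divisible by 4.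
  let N : Fin n → ℕ := fun s => (A.filter fun i => i - s ∈ A).card
  have hN2 : ∀ s, 2 ∣ N s := by
    intro s
    rw [← ZMod.natCast_eq_zero_iff, ← h s]
    change ((A.filter fun i => i - s ∈ A).card : ZMod 2) = _
    rw [Finset.card_filter, Finset.sum_filter]
    push_cast
    refine Finset.sum_congr rfl fun i _ => ?_
    rcases ZMod.eq_zero_or_one_of_two (c i) with h1 | h1 <;>
    rcases ZMod.eq_zero_or_one_of_two (c (i - s)) with h2 | h2 <;>
    simp [hA, h1, h2]
  have hNneg : ∀ s, N (-s) = N s := by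
    intro s
    refine Finset.card_bij' (fun i _ => i + s) (fun i _ => i - s) ?_ ?_ ?_ ?_
    · intro i hi
      simp only [Finset.mem_filter, sub_neg_eq_add] at hi
      simp [hi]
    · intro i hi
      simp only [Finset.mem_filter] at hi
      simp [hi]
    · simp
    · simp
  have hNsum : ∑ s, N s = A.card * A.card := by
    have h1 : ∀ s, N s = ∑ i ∈ A, if i - s ∈ A then 1 else 0 := fun s => Finset.card_filter _ _
    simp only [h1]
    rw [Finset.sum_comm, Finset.sum_const_nat (m := A.card)]
    intro i _
    rw [← Finset.card_filter]
    refine Finset.card_bij' (fun s _ => i - s) (fun s _ => i - s) ?_ ?_ ?_ ?_ <;> simp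
  have hN0 : N 0 = A.card := by
    simp [N]
  have hodd : ∀ s : Fin n, s ≠ 0 → -s ≠ s := by
    intro s hs e
    have h1 : (s + s).val = 0 := by
      nth_rewrite 1 [← e]
      simp
    rw [Fin.val_add] at h1
    obtain ⟨k, hk⟩ := Nat.dvd_of_mod_eq_zero h1
    obtain ⟨l, hl⟩ := hn
    have hs0 : (s : ℕ) ≠ 0 := fun e => hs (Fin.ext e)
    have := s.2
    have hk2 : k < 2 := by
      by_contra! hk2
      have := Nat.mul_le_mul_left n hk2
      omega
    interval_cases k <;> omega
  choose M hM using hN2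
  have hMsum : 2 ∣ ∑ s ∈ Finset.univ.erase 0, M s := by
    rw [← ZMod.natCast_eq_zero_iff]
    push_cast
    refine Finset.sum_involution (fun s _ => -s) ?_ ?_ ?_ ?_
    · intro s _
      have : M (-s) = M s := by
        have h1 := hNneg s
        rw [hM, hM s] at h1
        omega
      rw [this, CharTwo.add_self_eq_zero]
    · intro s hs _
      exact hodd s (Finset.ne_of_mem_erase hs)
    · intro s hs
      simpa using hs
    · simp
  have hw : A.card * A.card = A.card + 2 * ∑ s ∈ Finset.univ.erase 0, M s := by
    rw [← hNsum, ← Finset.add_sum_erase _ _ (Finset.mem_univ 0), hN0, Finset.mul_sum]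
    simp only [hM]
  have heven : 2 ∣ A.card := by
    rw [← ZMod.natCast_eq_zero_iff, ← hc]
    exact natCast_hammingNorm c
  change 4 ∣ A.card
  obtain ⟨u, hu⟩ := heven
  obtain ⟨v, hv⟩ := hMsum
  rw [hv, hu] at hw
  rw [hu]
  have : 2 ∣ u := by
    have h1 : u = 2 * (u * u - v) := by
      have : 2 * (u * u) = u + 2 * v := by linarith
      omega
    exact ⟨_, h1⟩
  omega

end CyclicCodes

/-! ### Adjoining the zero at exponent 0 -/

section InsertZero

variable {F : Type*} [Field F] [Algebra (ZMod 2) F] {n : ℕ} {a : F} {T : Finset (ZMod n)}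

theorem mem_zeroCode_insert_zero {c : Fin n → ZMod 2} :
    c ∈ zeroCode a (insert 0 T) ↔ ∑ i, c i = 0 ∧ c ∈ zeroCode a T := by
  simp only [mem_zeroCode, Finset.mem_insert, forall_eq_or_imp, ZMod.val_zero, pow_zero,
    wordEval_one, map_eq_zero]

theorem two_mul_mem_insert_zero (hT : ∀ i ∈ T, 2 * i ∈ T) :
    ∀ i ∈ insert 0 T, 2 * i ∈ insert 0 T := by
  intro i hi
  rcases Finset.mem_insert.1 hi with rfl | hi
  · simp
  · exact Finset.mem_insert_of_mem (hT i hi)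

end InsertZero

/-! ### Codes whose defining set is split by negation -/

section Splitting

variable {F : Type*} [Field F] [Algebra (ZMod 2) F] {n : ℕ} [NeZero n] {a : F}
  {T : Finset (ZMod n)}

theorem two_mul_card_add_one_of_splitting (hn : Odd n) (h0 : 0 ∉ T)
    (hneg : ∀ i, i ≠ 0 → (-i ∈ T ↔ i ∉ T)) : 2 * T.card + 1 = n := by
  have h1 : (Tᶜ.erase 0).card = T.card := by
    refine Finset.card_bij' (fun i _ => -i) (fun i _ => -i) ?_ ?_ ?_ ?_
    · intro i hi
      rw [Finset.mem_erase, Finset.mem_compl] at hi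
      exact (hneg i hi.1).2 hi.2
    · intro i hi
      have hi0 : i ≠ 0 := fun e => h0 (e ▸ hi)
      rw [Finset.mem_erase, Finset.mem_compl]
      refine ⟨neg_ne_zero.2 hi0, fun h => (hneg i hi0).1 h hi⟩
    · simp
    · simp
  rw [Finset.card_erase_of_mem (by simpa using h0), Finset.card_compl, ZMod.card] at h1
  have h2 := Finset.card_le_univ T
  rw [ZMod.card] at h2
  obtain ⟨k, hk⟩ := hn
  have : T.card < n := by
    have h3 := Finset.card_lt_univ_of_notMem h0
    rwa [ZMod.card] at h3
  omega

theorem sum_mul_eq_of_mem_zeroCode (ha : IsPrimitiveRoot a n) (hn : Odd n)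
    (hneg : ∀ i, i ≠ 0 → (-i ∈ T ↔ i ∉ T)) {x y : Fin n → ZMod 2}
    (hx : x ∈ zeroCode a T) (hy : y ∈ zeroCode a T) :
    ∑ i, x i * y i = (∑ i, x i) * ∑ i, y i := by
  refine sum_mul_eq_of_forall_wordEval ha hn fun j hj => ?_
  by_cases hjT : j ∈ T
  · exact Or.inl (hx j hjT)
  · exact Or.inr (hy _ ((hneg j hj).2 hjT))

/-- The even-weight subcode is orthogonal to the whole code, and the dimensions agree. -/
theorem dualCode_zeroCode (ha : IsPrimitiveRoot a n) (hn : Odd n) (hT : ∀ i ∈ T, 2 * i ∈ T)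
    (h0 : 0 ∉ T) (hneg : ∀ i, i ≠ 0 → (-i ∈ T ↔ i ∉ T)) :
    dualCode (zeroCode a T) = zeroCode a (insert 0 T) := by
  symm
  refine Submodule.eq_of_le_of_finrank_eq ?_ ?_
  · intro y hy x hx
    rw [mem_zeroCode_insert_zero] at hy
    rw [sum_mul_eq_of_mem_zeroCode ha hn hneg hx hy.2, hy.1, mul_zero]
  · have h1 := finrank_dualCode_add_finrank (zeroCode a T)
    have h2 := two_mul_card_add_one_of_splitting hn h0 hneg
    rw [finrank_zeroCode ha hn hT, Fintype.card_fin] at h1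
    rw [finrank_zeroCode ha hn (two_mul_mem_insert_zero hT), Finset.card_insert_of_notMem h0]
    omega

theorem four_dvd_hammingNorm_of_mem_zeroCode (ha : IsPrimitiveRoot a n) (hn : Odd n)
    (hneg : ∀ i, i ≠ 0 → (-i ∈ T ↔ i ∉ T)) {c : Fin n → ZMod 2} (hc : c ∈ zeroCode a T)
    (hc0 : ∑ i, c i = 0) : 4 ∣ hammingNorm c := by
  refine four_dvd_hammingNorm_of_orthogonal_shifts hn hc0 fun s => ?_
  have hs : (fun i => c (i - s)) ∈ zeroCode a T := by
    intro i hi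
    rw [wordEval_shift (ha.pow_val_pow_eq_one _), hc i hi, mul_zero]
  have := sum_mul_eq_of_mem_zeroCode ha hn hneg hc hs
  rwa [hc0, zero_mul] at this

theorem isDoublyEven_extendedCode_zeroCode (ha : IsPrimitiveRoot a n) (hn : 4 ∣ n + 1)
    (h0 : 0 ∉ T) (hneg : ∀ i, i ≠ 0 → (-i ∈ T ↔ i ∉ T)) :
    IsDoublyEven (extendedCode (zeroCode a T)) :=
  isDoublyEven_extendedCode hn (one_mem_zeroCode ha h0) fun _ hc hc0 =>
    four_dvd_hammingNorm_of_mem_zeroCode ha (by rw [Nat.odd_iff]; omega) hneg hc hc0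

theorem isSelfDual_extendedCode_zeroCode (ha : IsPrimitiveRoot a n) (hn : Odd n)
    (hT : ∀ i ∈ T, 2 * i ∈ T) (h0 : 0 ∉ T) (hneg : ∀ i, i ≠ 0 → (-i ∈ T ↔ i ∉ T)) :
    IsSelfDual (extendedCode (zeroCode a T)) := by
  refine isSelfDual_of_orthogonal ?_ ?_
  · intro x hx y hy
    rw [Fin.sum_univ_castSucc, sum_mul_eq_of_mem_zeroCode ha hn hneg hx.1 hy.1,
      extendedCode_last hx, extendedCode_last hy, CharTwo.add_self_eq_zero]
  · have h2 := two_mul_card_add_one_of_splitting hn h0 hneg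
    rw [finrank_extendedCode, finrank_zeroCode ha hn hT, Fintype.card_fin]
    omega

section Distance

variable {v δ : ℕ}

/-- The multiples of `v` become consecutive exponents of the primitive root `a ^ v`, starting at 1;
with 0 adjoined the run starts one step earlier. -/
theorem lt_hammingNorm_of_mem_zeroCode (ha : IsPrimitiveRoot a n) (hv : v.Coprime n)
    (hrun : ∀ k, 1 ≤ k → k ≤ δ → ((k * v : ℕ) : ZMod n) ∈ T) {c : Fin n → ZMod 2}
    (hc : c ∈ zeroCode a T) (hc0 : c ≠ 0) : δ + 1 ≤ hammingNorm c := by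
  refine bch_bound (ha.pow_of_coprime v hv) hc0 (b := 1) fun k hk => ?_
  have := hc _ (hrun (1 + k) (by omega) (by omega))
  rwa [ha.pow_val_natCast, mul_comm, pow_mul] at this

theorem lt_hammingNorm_of_mem_zeroCode_insert_zero (ha : IsPrimitiveRoot a n) (hv : v.Coprime n)
    (hrun : ∀ k, 1 ≤ k → k ≤ δ → ((k * v : ℕ) : ZMod n) ∈ T) {c : Fin n → ZMod 2}
    (hc : c ∈ zeroCode a (insert 0 T)) (hc0 : c ≠ 0) : δ + 2 ≤ hammingNorm c := by
  refine bch_bound (ha.pow_of_coprime v hv) hc0 (b := 0) fun k hk => ?_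
  have hk' : ((k * v : ℕ) : ZMod n) ∈ insert 0 T := by
    rcases Nat.eq_zero_or_pos k with rfl | hk0
    · simp
    · exact Finset.mem_insert_of_mem (hrun k hk0 (by omega))
  have := hc _ hk'
  rwa [ha.pow_val_natCast, mul_comm, pow_mul, ← zero_add k] at this

theorem lt_hammingNorm_of_mem_extendedCode (ha : IsPrimitiveRoot a n) (hv : v.Coprime n)
    (hrun : ∀ k, 1 ≤ k → k ≤ δ → ((k * v : ℕ) : ZMod n) ∈ T) {c : Fin (n + 1) → ZMod 2}
    (hc : c ∈ extendedCode (zeroCode a T)) (hc0 : c ≠ 0) : δ + 1 ≤ hammingNorm c := by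
  have h := hammingNorm_extended c
  refine (lt_hammingNorm_of_mem_zeroCode ha hv hrun hc.1 fun e => hc0 ?_).trans (by omega)
  have e' : ∀ i : Fin n, c i.castSucc = 0 := fun i => congrFun e i
  ext i
  refine Fin.lastCases ?_ e' i
  rw [extendedCode_last hc]
  simp [e']

end Distance

end Splitting

/-! ### Binary weights of complements, rotations and multiples of 2^h - 1 -/

theorem binaryWeight_zero : binaryWeight 0 = 0 := by simp [binaryWeight]

theorem binaryWeight_two_mul (k : ℕ) : binaryWeight (2 * k) = binaryWeight k := by
  rcases Nat.eq_zero_or_pos k with rfl | hk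
  · simp
  · simp [binaryWeight, Nat.digits_def' (by norm_num : 1 < 2) (show 0 < 2 * k by omega)]

theorem binaryWeight_two_mul_add_one (k : ℕ) : binaryWeight (2 * k + 1) = binaryWeight k + 1 := by
  have h1 : (2 * k + 1) % 2 = 1 := by omega
  have h2 : (2 * k + 1) / 2 = k := by omega
  rw [binaryWeight, Nat.digits_def' (by norm_num : 1 < 2) (by omega), h1, h2, List.sum_cons,
    add_comm, binaryWeight]

theorem binaryWeight_mul_pow_add (h x y : ℕ) (hy : y < 2 ^ h) :
    binaryWeight (x * 2 ^ h + y) = binaryWeight x + binaryWeight y := by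
  induction h generalizing y with
  | zero =>
    have : y = 0 := by simpa using hy
    simp [this, binaryWeight_zero]
  | succ h ih =>
    rw [pow_succ] at hy ⊢
    rcases Nat.even_or_odd' y with ⟨k, rfl | rfl⟩
    · rw [show x * (2 ^ h * 2) + 2 * k = 2 * (x * 2 ^ h + k) by ring, binaryWeight_two_mul,
        binaryWeight_two_mul, ih _ (by omega)]
    · rw [show x * (2 ^ h * 2) + (2 * k + 1) = 2 * (x * 2 ^ h + k) + 1 by ring,
        binaryWeight_two_mul_add_one, binaryWeight_two_mul_add_one, ih _ (by omega), add_assoc]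

theorem binaryWeight_one : binaryWeight 1 = 1 := by simp [binaryWeight]

theorem binaryWeight_compl (m j : ℕ) (hj : j < 2 ^ m) :
    binaryWeight (2 ^ m - 1 - j) + binaryWeight j = m := by
  induction m generalizing j with
  | zero =>
    have : j = 0 := by simpa using hj
    simp [this, binaryWeight_zero]
  | succ m ih =>
    rw [pow_succ] at hj ⊢
    rcases Nat.even_or_odd' j with ⟨k, rfl | rfl⟩
    · rw [show 2 ^ m * 2 - 1 - 2 * k = 2 * (2 ^ m - 1 - k) + 1 by omega,
        binaryWeight_two_mul, binaryWeight_two_mul_add_one]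
      have := ih k (by omega)
      omega
    · rw [show 2 ^ m * 2 - 1 - (2 * k + 1) = 2 * (2 ^ m - 1 - k) by omega,
        binaryWeight_two_mul, binaryWeight_two_mul_add_one]
      have := ih k (by omega)
      omega

theorem binaryWeight_two_pow_sub_one (h : ℕ) : binaryWeight (2 ^ h - 1) = h := by
  have := binaryWeight_compl h 0 (by positivity)
  simpa [binaryWeight_zero] using this

theorem binaryWeight_mul_two_pow_sub_one (h a : ℕ) (ha : 1 ≤ a) (ha' : a ≤ 2 ^ h) :
    binaryWeight (a * (2 ^ h - 1)) = h := by
  obtain ⟨b, rfl⟩ := Nat.exists_eq_add_of_le' ha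
  -- The high block is `b` and the low block is its `h`-bit complement, so the weights add up to
  -- `h`.
  have e : (b + 1) * (2 ^ h - 1) = b * 2 ^ h + (2 ^ h - 1 - b) := by
    zify [show b ≤ 2 ^ h - 1 by omega, Nat.one_le_two_pow (n := h)]
    ring
  rw [e, binaryWeight_mul_pow_add _ _ _ (by omega)]
  have := binaryWeight_compl h b (by omega)
  omega

theorem binaryWeight_two_pow_add_one_mul (h : ℕ) :
    binaryWeight ((2 ^ h + 1) * (2 ^ h - 1)) = 2 * h := by
  have e : (2 ^ h + 1) * (2 ^ h - 1) = 2 ^ (2 * h) - 1 := by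
    zify [Nat.one_le_two_pow (n := h), Nat.one_le_two_pow (n := 2 * h)]
    ring
  rw [e, binaryWeight_two_pow_sub_one]

theorem binaryWeight_two_pow_add_two_mul (h : ℕ) (hh : 1 ≤ h) :
    binaryWeight ((2 ^ h + 2) * (2 ^ h - 1)) = h := by
  obtain ⟨k, rfl⟩ := Nat.exists_eq_add_of_le' hh
  have h1 := Nat.one_le_two_pow (n := k)
  have h2 := Nat.one_le_two_pow (n := k + 1)
  -- One leading bit, plus `k` ones from the doubled 2^k - 1.
  have e : (2 ^ (k + 1) + 2) * (2 ^ (k + 1) - 1) = 2 ^ (k + 1) * 2 ^ (k + 1) + 2 * (2 ^ k - 1) := by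
    zify [h1, h2]
    ring
  rw [e, binaryWeight_mul_pow_add _ _ _ (by rw [pow_succ]; omega), binaryWeight_two_mul,
    binaryWeight_two_pow_sub_one]
  have := binaryWeight_mul_pow_add (k + 1) 1 0 (by positivity)
  simp only [one_mul, add_zero, binaryWeight_one, binaryWeight_zero] at this
  omega

/-- Doubling modulo 2^m - 1 rotates the `m` binary digits. -/
theorem binaryWeight_double_mod {m j : ℕ} (hj : j < 2 ^ m - 1) :
    binaryWeight (2 * j % (2 ^ m - 1)) = binaryWeight j := by
  obtain _ | m := m
  · simp at hj
  have hp := Nat.one_le_two_pow (n := m)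
  rw [pow_succ] at hj ⊢
  rcases lt_or_ge j (2 ^ m) with h | h
  · rcases lt_or_ge (2 * j) (2 ^ m * 2 - 1) with h' | h'
    · rw [Nat.mod_eq_of_lt h', binaryWeight_two_mul]
    · omega
  · obtain ⟨l, rfl⟩ := Nat.exists_eq_add_of_le h
    have e : 2 * (2 ^ m + l) = (2 * l + 1) + (2 ^ m * 2 - 1) := by omega
    rw [e, Nat.add_mod_right, Nat.mod_eq_of_lt (by omega), binaryWeight_two_mul_add_one]
    have := binaryWeight_mul_pow_add m 1 l (by omega)
    rw [one_mul, binaryWeight_one] at this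
    omega

theorem coprime_two_pow_sub_one (h : ℕ) : (2 ^ h - 1).Coprime (2 ^ (2 * h + 1) - 1) := by
  rw [Nat.Coprime, Nat.pow_sub_one_gcd_pow_sub_one]
  have : Nat.gcd h (2 * h + 1) = 1 := by
    rw [mul_comm]
    simp
  simp [this]

/-! ### Defining sets cut out by binary weight -/

section WeightCodes

/-- The nonzero residues modulo `n` whose binary weight modulo `r` lies in `S`. -/
def weightZeros (n : ℕ) {r : ℕ} [NeZero n] (S : Finset (ZMod r)) : Finset (ZMod n) :=
  Finset.univ.filter fun i => i ≠ 0 ∧ ((binaryWeight i.val : ℕ) : ZMod r) ∈ S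

theorem mem_weightZeros {n r : ℕ} [NeZero n] {S : Finset (ZMod r)} {i : ZMod n} :
    i ∈ weightZeros n S ↔ i ≠ 0 ∧ ((binaryWeight i.val : ℕ) : ZMod r) ∈ S := by
  simp [weightZeros]

theorem natCast_mem_weightZeros {n r : ℕ} [NeZero n] {S : Finset (ZMod r)} {j : ℕ} (hj : 0 < j)
    (hjn : j < n) (h : ((binaryWeight j : ℕ) : ZMod r) ∈ S) : (j : ZMod n) ∈ weightZeros n S := by
  rw [mem_weightZeros, ZMod.val_natCast_of_lt hjn]
  refine ⟨?_, h⟩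
  rw [Ne, ZMod.natCast_eq_zero_iff]
  exact fun hd => absurd (Nat.le_of_dvd hj hd) (by omega)

theorem zero_notMem_weightZeros {n r : ℕ} [NeZero n] {S : Finset (ZMod r)} :
    0 ∉ weightZeros n S := by
  simp [mem_weightZeros]

theorem mem_weightZeros_compl {n r : ℕ} [NeZero n] [NeZero r] {S : Finset (ZMod r)} {i : ZMod n}
    (hi : i ≠ 0) : i ∈ weightZeros n Sᶜ ↔ i ∉ weightZeros n S := by
  simp [mem_weightZeros, hi]

variable {r m : ℕ} [NeZero (2 ^ m - 1)] {S : Finset (ZMod r)}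

theorem two_mul_mem_weightZeros (hm : 1 ≤ m) :
    ∀ i ∈ weightZeros (2 ^ m - 1) S, 2 * i ∈ weightZeros (2 ^ m - 1) S := by
  intro i hi
  rw [mem_weightZeros] at hi ⊢
  have hodd : Odd (2 ^ m - 1) := by
    obtain ⟨k, rfl⟩ := Nat.exists_eq_add_of_le' hm
    exact ⟨2 ^ k - 1, by have := Nat.one_le_two_pow (n := k); rw [pow_succ]; omega⟩
  refine ⟨fun e => hi.1 (ZMod.two_mul_injective_of_odd hodd (by simpa using e)), ?_⟩
  have e : (2 * i).val = 2 * i.val % (2 ^ m - 1) := by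
    rw [two_mul, ZMod.val_add, two_mul]
  rw [e, binaryWeight_double_mod (ZMod.val_lt i)]
  exact hi.2

/-- Negation modulo 2^m - 1 complements the digits, turning weight w into m - w. -/
theorem mem_weightZeros_compl_iff_neg_mem [NeZero r]
    (hS : ∀ j : ZMod r, j ∈ Sᶜ ↔ (m : ZMod r) - j ∈ S) (i : ZMod (2 ^ m - 1)) :
    i ∈ weightZeros (2 ^ m - 1) Sᶜ ↔ -i ∈ weightZeros (2 ^ m - 1) S := by
  rw [mem_weightZeros, mem_weightZeros, neg_ne_zero, hS]
  refine and_congr_right fun hi => ?_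
  have : NeZero i := ⟨hi⟩
  rw [ZMod.val_neg_of_ne_zero]
  have h := binaryWeight_compl m i.val (by have := ZMod.val_lt i; omega)
  have h2 : ((binaryWeight (2 ^ m - 1 - i.val) : ℕ) : ZMod r) = m - (binaryWeight i.val : ℕ) := by
    rw [eq_sub_iff_add_eq]
    exact_mod_cast congrArg (Nat.cast : ℕ → ZMod r) h
  rw [h2]

theorem neg_mem_weightZeros_iff [NeZero r]
    (hS : ∀ j : ZMod r, j ∈ Sᶜ ↔ (m : ZMod r) - j ∈ S) (i : ZMod (2 ^ m - 1)) (hi : i ≠ 0) :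
    -i ∈ weightZeros (2 ^ m - 1) S ↔ i ∉ weightZeros (2 ^ m - 1) S := by
  rw [← mem_weightZeros_compl_iff_neg_mem hS, mem_weightZeros_compl hi]

theorem weightCode_eq_zeroCode {F : Type*} [Field F] [Algebra (ZMod 2) F] {a : F}
    (ha : IsPrimitiveRoot a (2 ^ m - 1)) :
    weightCode r m S a = zeroCode a (weightZeros (2 ^ m - 1) S) := by
  ext c
  have hlt : ∀ i ∈ weightSet r m S, 0 < i ∧ i < 2 ^ m - 1 := by
    intro i hi
    rw [weightSet, Finset.mem_filter, Finset.mem_Icc] at hi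
    omega
  have hinj : Set.InjOn (fun i : ℕ => a ^ i) (weightSet r m S) := fun i hi j hj h =>
    ha.pow_inj (hlt i hi).2 (hlt j hj).2 h
  change weightGenPoly r m S a ∣ _ ↔ _
  rw [weightGenPoly, prod_X_sub_C_dvd_iff hinj, mem_zeroCode]
  simp only [eval_map_wordPoly]
  constructor
  · intro h i hi
    refine h _ ?_
    rw [mem_weightZeros] at hi
    rw [weightSet, Finset.mem_filter, Finset.mem_Icc]
    have h1 := ZMod.val_lt i
    have h2 := ZMod.val_pos.2 hi.1
    exact ⟨by omega, hi.2⟩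
  · intro h i hi
    have h1 := h i (natCast_mem_weightZeros (hlt i hi).1 (hlt i hi).2 (Finset.mem_filter.1 hi).2)
    rwa [ha.pow_val_natCast] at h1

theorem isSplitting_weightZeros [NeZero r] (hm : 1 ≤ m)
    (hS : ∀ j : ZMod r, j ∈ Sᶜ ↔ (m : ZMod r) - j ∈ S) :
    IsSplitting (weightZeros (2 ^ m - 1) S : Set (ZMod (2 ^ m - 1)))
      (weightZeros (2 ^ m - 1) Sᶜ : Set (ZMod (2 ^ m - 1))) (-1) := by
  have hneg := mem_weightZeros_compl_iff_neg_mem hS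
  refine ⟨two_mul_mem_weightZeros hm, two_mul_mem_weightZeros hm, ?_, ?_, ?_, ?_⟩
  · ext i
    by_cases hi : i = 0
    · subst hi
      simp [zero_notMem_weightZeros]
    · simp [mem_weightZeros_compl hi, hi, em]
  · ext i
    by_cases hi : i = 0
    · subst hi
      simp [zero_notMem_weightZeros]
    · simp [mem_weightZeros_compl hi]
  · ext i
    simp only [Units.val_neg, Units.val_one, mul_neg, mul_one, Set.image_neg_eq_neg, Set.mem_neg,
      Finset.mem_coe, hneg]
  · ext i
    simp only [Units.val_neg, Units.val_one, mul_neg, mul_one, Set.image_neg_eq_neg, Set.mem_neg,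
      Finset.mem_coe, hneg, neg_neg]

end WeightCodes

/-! ### Arithmetic progressions in the defining set -/

section Runs

/-- Ensures that the progression never wraps around modulo `n`, so weights may be computed on the
integers themselves. -/
theorem two_pow_add_two_mul_lt {h : ℕ} (hh : 1 ≤ h) :
    (2 ^ h + 2) * (2 ^ h - 1) < 2 ^ (2 * h + 1) - 1 := by
  have h1 : 2 ≤ 2 ^ h := by
    simpa using Nat.pow_le_pow_right (show 0 < 2 by norm_num) hh
  obtain ⟨x, hx⟩ := Nat.exists_eq_add_of_le h1
  have e : 2 ^ (2 * h + 1) = 2 * (2 ^ h * 2 ^ h) := by ring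
  rw [e, hx, show 2 + x - 1 = x + 1 by omega]
  refine Nat.lt_sub_of_add_lt ?_
  nlinarith

variable {r h : ℕ} [NeZero (2 ^ (2 * h + 1) - 1)] {S : Finset (ZMod r)}

theorem mul_mem_weightZeros (hh : 1 ≤ h) (hS : ((h : ℕ) : ZMod r) ∈ S) {k : ℕ} (hk : 1 ≤ k)
    (hk' : k ≤ 2 ^ h) :
    ((k * (2 ^ h - 1) : ℕ) : ZMod (2 ^ (2 * h + 1) - 1)) ∈ weightZeros (2 ^ (2 * h + 1) - 1) S := by
  have h1 : 2 ≤ 2 ^ h := by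
    simpa using Nat.pow_le_pow_right (show 0 < 2 by norm_num) hh
  refine natCast_mem_weightZeros (Nat.mul_pos hk (by omega)) ?_ ?_
  · exact (Nat.mul_le_mul_right _ (by omega)).trans_lt (two_pow_add_two_mul_lt hh)
  · rwa [binaryWeight_mul_two_pow_sub_one h k hk hk']

theorem mul_mem_weightZeros_of_two_mul_mem (hh : 1 ≤ h) (hS : ((h : ℕ) : ZMod r) ∈ S)
    (hS2 : ((2 * h : ℕ) : ZMod r) ∈ S) {k : ℕ} (hk : 1 ≤ k) (hk' : k ≤ 2 ^ h + 2) :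
    ((k * (2 ^ h - 1) : ℕ) : ZMod (2 ^ (2 * h + 1) - 1)) ∈ weightZeros (2 ^ (2 * h + 1) - 1) S := by
  have h1 : 2 ≤ 2 ^ h := by
    simpa using Nat.pow_le_pow_right (show 0 < 2 by norm_num) hh
  rcases Nat.lt_or_ge (2 ^ h) k with hlt | hle
  · refine natCast_mem_weightZeros (Nat.mul_pos hk (by omega)) ?_ ?_
    · exact (Nat.mul_le_mul_right _ (by omega)).trans_lt (two_pow_add_two_mul_lt hh)
    · obtain rfl | rfl : k = 2 ^ h + 1 ∨ k = 2 ^ h + 2 := by omega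
      · rwa [binaryWeight_two_pow_add_one_mul]
      · rwa [binaryWeight_two_pow_add_two_mul h hh]
  · exact mul_mem_weightZeros hh hS hk hle

end Runs

/-! ### Which of the two sets contains h and 2h -/

section ResidueConditions

variable {r h : ℕ} [NeZero r] {t : ℤ} {S : Finset (ZMod r)}

theorem mem_compl_iff_sub_mem (hpair : Sᶜ = S.image (fun i => (t : ZMod r) - i)) (j : ZMod r) :
    j ∈ Sᶜ ↔ (t : ZMod r) - j ∈ S := by
  rw [hpair, Finset.mem_image]
  constructor
  · rintro ⟨i, hi, rfl⟩
    rwa [sub_sub_cancel]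
  · intro hj
    exact ⟨_, hj, sub_sub_cancel _ _⟩

theorem modEq_or_modEq_add_of_modEq {x y s : ℤ} (hxy : x ≡ y [ZMOD s]) :
    x ≡ y [ZMOD 2 * s] ∨ x ≡ y + s [ZMOD 2 * s] := by
  obtain ⟨k, hk⟩ := hxy.dvd
  rcases Int.even_or_odd' k with ⟨l, rfl | rfl⟩
  · exact Or.inl (Int.modEq_iff_dvd.2 ⟨l, by rw [hk]; ring⟩)
  · exact Or.inr (Int.modEq_iff_dvd.2 ⟨l + 1, by linear_combination hk⟩)

/-- One of `S`, `Sᶜ` contains `h`, and also `2 * h` if `2 * h + 1` is congruent to `t`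
modulo `2 * r`. -/
theorem exists_mem_of_residue_conditions
    (hmt : ((2 * h + 1 : ℕ) : ℤ) ≡ t [ZMOD (r : ℤ)])
    (hpair : ∀ j : ZMod r, j ∈ Sᶜ ↔ ((2 * h + 1 : ℕ) : ZMod r) - j ∈ S)
    (hS : ((((t - 1) / 2 : ℤ) : ZMod r) ∈ S ∧ (((t + r + 1) / 2 : ℤ) : ZMod r) ∈ S ∧
            ((t - 1 : ℤ) : ZMod r) ∈ S) ∨
          ((((t + 1) / 2 : ℤ) : ZMod r) ∈ S ∧ (((t + r - 1) / 2 : ℤ) : ZMod r) ∈ S ∧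
            (1 : ZMod r) ∈ S)) :
    ∃ U : Finset (ZMod r), (U = S ∨ U = Sᶜ) ∧ (h : ZMod r) ∈ U ∧
      (((2 * h + 1 : ℕ) : ℤ) ≡ t [ZMOD (2 * r : ℤ)] → ((2 * h : ℕ) : ZMod r) ∈ U) := by
  have hr0 : ((r : ℤ) : ZMod r) = 0 := by simp
  rcases modEq_or_modEq_add_of_modEq hmt with hc | hc
  · obtain ⟨k, hk⟩ := hc.dvd
    -- Modulo r, (t - 1)/2 is h and t - 1 is 2h. In the second alternative `S` contains h + 1 = m -
    -- h and 1 = m - 2h, so the complement contains h and 2h.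
    have hk' : t = 2 * (h + r * k) + 1 := by push_cast at hk; linear_combination hk
    rcases hS with ⟨h1, -, h3⟩ | ⟨h1, -, h3⟩
    · refine ⟨S, Or.inl rfl, ?_, fun _ => ?_⟩
      · have e : (t - 1) / 2 = h + r * k := by omega
        rw [e] at h1
        simpa using h1
      · rw [hk'] at h3
        simpa using h3
    · refine ⟨Sᶜ, Or.inr rfl, ?_, fun _ => ?_⟩
      · have e : (t + 1) / 2 = h + r * k + 1 := by omega
        rw [e] at h1
        rw [hpair]
        convert h1 using 1
        push_cast
        simp
        ring
      · rw [hpair]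
        convert h3 using 1
        push_cast
        ring
  · have hne : ¬((2 * h + 1 : ℕ) : ℤ) ≡ t [ZMOD (2 * r : ℤ)] := by
      intro h'
      have h1 := (h'.symm.trans hc).dvd
      rw [add_sub_cancel_left] at h1
      have h2 : (0 : ℤ) < r := by exact_mod_cast NeZero.pos r
      have := Int.le_of_dvd h2 h1
      omega
    obtain ⟨k, hk⟩ := hc.dvd
    -- Now (t + r - 1)/2 is h modulo r, and (t + r + 1)/2 is h + 1 = m - h.
    have hk' : t + r = 2 * (h + r * k) + 1 := by push_cast at hk; linear_combination hk
    rcases hS with ⟨-, h1, -⟩ | ⟨-, h1, -⟩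
    · refine ⟨Sᶜ, Or.inr rfl, ?_, fun h' => absurd h' hne⟩
      have e : (t + r + 1) / 2 = h + r * k + 1 := by omega
      rw [e] at h1
      rw [hpair]
      convert h1 using 1
      push_cast
      simp
      ring
    · refine ⟨S, Or.inl rfl, ?_, fun h' => absurd h' hne⟩
      have e : (t + r - 1) / 2 = h + r * k := by omega
      rw [e] at h1
      simpa using h1

end ResidueConditions

/-! ### Equal distances by reversal, and the main theorem -/

section MinimumDistances

variable {F : Type*} [Field F] [Algebra (ZMod 2) F] {a : F} {n : ℕ} [NeZero n]
  {T T' : Finset (ZMod n)}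

theorem minDist_zeroCode_eq (ha : IsPrimitiveRoot a n) (hT : ∀ i, i ∈ T' ↔ -i ∈ T) :
    minDist (zeroCode a T') = minDist (zeroCode a T) :=
  minDist_eq_of_equiv Fin.revPerm (comp_rev_mem_zeroCode_iff ha hT)

theorem minDist_dualCode_zeroCode_eq (ha : IsPrimitiveRoot a n) (hT : ∀ i, i ∈ T' ↔ -i ∈ T) :
    minDist (dualCode (zeroCode a T')) = minDist (dualCode (zeroCode a T)) :=
  minDist_eq_of_equiv Fin.revPerm
    (mem_dualCode_iff_of_equiv Fin.revPerm (comp_rev_mem_zeroCode_iff ha hT))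

theorem minDist_extendedCode_zeroCode_eq (ha : IsPrimitiveRoot a n)
    (hT : ∀ i, i ∈ T' ↔ -i ∈ T) :
    minDist (extendedCode (zeroCode a T')) = minDist (extendedCode (zeroCode a T)) :=
  minDist_extendedCode_eq_of_equiv Fin.revPerm (comp_rev_mem_zeroCode_iff ha hT)

theorem finrank_codes_of_splitting (ha : IsPrimitiveRoot a n) (hn : Odd n)
    (hT : ∀ i ∈ T, 2 * i ∈ T) (h0 : 0 ∉ T) (hneg : ∀ i, i ≠ 0 → (-i ∈ T ↔ i ∉ T)) {k : ℕ}
    (hk : 2 * k = n + 1) :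
    Module.finrank (ZMod 2) (zeroCode a T) = k ∧
    Module.finrank (ZMod 2) (dualCode (zeroCode a T)) = k - 1 ∧
    Module.finrank (ZMod 2) (extendedCode (zeroCode a T)) = k := by
  have h1 := finrank_dualCode_add_finrank (zeroCode a T)
  have h2 := two_mul_card_add_one_of_splitting hn h0 hneg
  rw [finrank_extendedCode]
  rw [Fintype.card_fin] at h1
  have h3 := finrank_zeroCode ha hn hT
  omega

end MinimumDistances

theorem theorem8 {F : Type*} [Field F] [Finite F] [Algebra (ZMod 2) F]
    (r m : ℕ) [NeZero r] (hr : Even r) (hm : Odd m) (hm3 : 3 ≤ m)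
    (hF : Nat.card F = 2 ^ m)
    (α : Fˣ) (hα : Subgroup.zpowers α = ⊤)
    (t : ℤ) (ht : Odd t) (ht3 : t ≠ 3) (hmt : (m : ℤ) ≡ t [ZMOD (r : ℤ)])
    (S : Finset (ZMod r)) (hcard : S.card = r / 2)
    (hpair : Sᶜ = S.image (fun i => (t : ZMod r) - i))
    (hS : ((((t - 1) / 2 : ℤ) : ZMod r) ∈ S ∧ (((t + r + 1) / 2 : ℤ) : ZMod r) ∈ S ∧
            ((t - 1 : ℤ) : ZMod r) ∈ S) ∨
          ((((t + 1) / 2 : ℤ) : ZMod r) ∈ S ∧ (((t + r - 1) / 2 : ℤ) : ZMod r) ∈ S ∧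
            (1 : ZMod r) ∈ S)) :
    (IsOddLikeDuadicPair (α : F) (weightCode r m S (α : F)) (weightCode r m Sᶜ (α : F)) ∧
      ∃ d : ℕ,
        HasParameters (weightCode r m S (α : F)) (2 ^ m - 1) (2 ^ (m - 1)) d ∧
        HasParameters (weightCode r m Sᶜ (α : F)) (2 ^ m - 1) (2 ^ (m - 1)) d ∧
        ((m : ℤ) ≡ t [ZMOD (2 * r : ℤ)] → 2 ^ ((m - 1) / 2) + 3 ≤ d) ∧
        ((m : ℤ) ≡ t + r [ZMOD (2 * r : ℤ)] → 2 ^ ((m - 1) / 2) + 1 ≤ d)) ∧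
    (IsEvenLikeDuadicPair (α : F) (dualCode (weightCode r m S (α : F)))
        (dualCode (weightCode r m Sᶜ (α : F))) ∧
      ∃ d : ℕ,
        HasParameters (dualCode (weightCode r m S (α : F)))
          (2 ^ m - 1) (2 ^ (m - 1) - 1) d ∧
        HasParameters (dualCode (weightCode r m Sᶜ (α : F)))
          (2 ^ m - 1) (2 ^ (m - 1) - 1) d ∧
        ((m : ℤ) ≡ t [ZMOD (2 * r : ℤ)] → 2 ^ ((m - 1) / 2) + 4 ≤ d) ∧
        ((m : ℤ) ≡ t + r [ZMOD (2 * r : ℤ)] → 2 ^ ((m - 1) / 2) + 2 ≤ d)) ∧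
    ((∃ d : ℕ,
        HasParameters (extendedCode (weightCode r m S (α : F))) (2 ^ m) (2 ^ (m - 1)) d ∧
        HasParameters (extendedCode (weightCode r m Sᶜ (α : F))) (2 ^ m) (2 ^ (m - 1)) d ∧
        (5 ≤ m → 2 ^ ((m - 1) / 2) + 4 ≤ d)) ∧
      IsSelfDual (extendedCode (weightCode r m S (α : F))) ∧
      IsSelfDual (extendedCode (weightCode r m Sᶜ (α : F))) ∧
      IsDoublyEven (extendedCode (weightCode r m S (α : F))) ∧
      IsDoublyEven (extendedCode (weightCode r m Sᶜ (α : F)))) := by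
  obtain ⟨h, rfl⟩ := hm
  have hh : 1 ≤ h := by omega
  have h2h : 2 ≤ 2 ^ h := by
    simpa using Nat.pow_le_pow_right (show 0 < 2 by norm_num) hh
  have hpow : 2 ^ (2 * h + 1) = 2 * 2 ^ (2 * h) := by rw [pow_succ, mul_comm]
  have hpow4 : 4 ∣ 2 ^ (2 * h + 1) := pow_dvd_pow 2 (show 2 ≤ 2 * h + 1 by omega)
  have hpos : 2 ≤ 2 ^ (2 * h) := by
    simpa using Nat.pow_le_pow_right (show 0 < 2 by norm_num) (show 1 ≤ 2 * h by omega)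
  have hnz : NeZero (2 ^ (2 * h + 1) - 1) := ⟨by omega⟩
  have hodd : Odd (2 ^ (2 * h + 1) - 1) := ⟨2 ^ (2 * h) - 1, by omega⟩
  have ha : IsPrimitiveRoot (α : F) (2 ^ (2 * h + 1) - 1) := by
    have h1 := IsPrimitiveRoot.orderOf (α : F)
    rwa [orderOf_units, orderOf_eq_card_of_zpowers_eq_top hα, Nat.card_units, hF] at h1
  have ht' : ((2 * h + 1 : ℕ) : ZMod r) = t := by
    have := (ZMod.intCast_eq_intCast_iff _ _ _).2 hmt
    exact_mod_cast this
  have hcompl : ∀ j : ZMod r, j ∈ Sᶜ ↔ ((2 * h + 1 : ℕ) : ZMod r) - j ∈ S := by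
    rw [ht']
    exact mem_compl_iff_sub_mem hpair
  have hcompl' : ∀ j : ZMod r, j ∈ Sᶜᶜ ↔ ((2 * h + 1 : ℕ) : ZMod r) - j ∈ Sᶜ := fun j => by
    rw [hcompl, sub_sub_cancel, compl_compl]
  obtain ⟨U, hUS, hhU, hU2⟩ := exists_mem_of_residue_conditions hmt hcompl hS
  simp only [weightCode_eq_zeroCode ha, Nat.add_sub_cancel,
    show 2 * h / 2 = h by omega]
  set T := weightZeros (2 ^ (2 * h + 1) - 1) S with hTdef
  set T' := weightZeros (2 ^ (2 * h + 1) - 1) Sᶜ with hT'def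
  have hT2 : ∀ i ∈ T, 2 * i ∈ T := two_mul_mem_weightZeros (by omega)
  have hT2' : ∀ i ∈ T', 2 * i ∈ T' := two_mul_mem_weightZeros (by omega)
  have hT0 : 0 ∉ T := zero_notMem_weightZeros
  have hT0' : 0 ∉ T' := zero_notMem_weightZeros
  have hTneg : ∀ i, i ≠ 0 → (-i ∈ T ↔ i ∉ T) := neg_mem_weightZeros_iff hcompl
  have hTneg' : ∀ i, i ≠ 0 → (-i ∈ T' ↔ i ∉ T') := neg_mem_weightZeros_iff hcompl'
  have hTT' : ∀ i, i ∈ T' ↔ -i ∈ T := mem_weightZeros_compl_iff_neg_mem hcompl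
  have hsplit : IsSplitting (T : Set (ZMod (2 ^ (2 * h + 1) - 1))) T' (-1) :=
    isSplitting_weightZeros (by omega) hcompl
  have hk : 2 * 2 ^ (2 * h) = 2 ^ (2 * h + 1) - 1 + 1 := by omega
  obtain ⟨hdim, hdimd, hdime⟩ := finrank_codes_of_splitting ha hodd hT2 hT0 hTneg hk
  obtain ⟨hdim', hdimd', hdime'⟩ := finrank_codes_of_splitting ha hodd hT2' hT0' hTneg' hk
  have hsub : 2 ^ (2 * h + 1) - 1 + 1 = 2 ^ (2 * h + 1) := Nat.sub_add_cancel (by omega)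
  have h4 : 4 ∣ 2 ^ (2 * h + 1) - 1 + 1 := by rwa [hsub]
  have hde := isDoublyEven_extendedCode_zeroCode ha h4 hT0 hTneg
  have hde' := isDoublyEven_extendedCode_zeroCode ha h4 hT0' hTneg'
  have hcop := coprime_two_pow_sub_one h
  have hmin := minDist_zeroCode_eq ha hTT'
  have hmind := minDist_dualCode_zeroCode_eq ha hTT'
  have hmine := minDist_extendedCode_zeroCode_eq ha hTT'
  -- `R` is whichever of `T`, `T'` contains the long progression; its three minimum distances are
  -- those of `T`.
  obtain ⟨R, hR2, hR0, hRneg, hRdim, hRdimd, hRdime, hRde, hRmin, hRmind, hRmine, hrun,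
      hrun2⟩ : ∃ R : Finset (ZMod (2 ^ (2 * h + 1) - 1)),
      (∀ i ∈ R, 2 * i ∈ R) ∧ 0 ∉ R ∧ (∀ i, i ≠ 0 → (-i ∈ R ↔ i ∉ R)) ∧
      0 < Module.finrank (ZMod 2) (zeroCode (α : F) R) ∧
      0 < Module.finrank (ZMod 2) (dualCode (zeroCode (α : F) R)) ∧
      0 < Module.finrank (ZMod 2) (extendedCode (zeroCode (α : F) R)) ∧
      IsDoublyEven (extendedCode (zeroCode (α : F) R)) ∧
      minDist (zeroCode (α : F) R) = minDist (zeroCode (α : F) T) ∧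
      minDist (dualCode (zeroCode (α : F) R)) = minDist (dualCode (zeroCode (α : F) T)) ∧
      minDist (extendedCode (zeroCode (α : F) R)) = minDist (extendedCode (zeroCode (α : F) T)) ∧
      (∀ k, 1 ≤ k → k ≤ 2 ^ h →
        ((k * (2 ^ h - 1) : ℕ) : ZMod (2 ^ (2 * h + 1) - 1)) ∈ R) ∧
      (((2 * h + 1 : ℕ) : ℤ) ≡ t [ZMOD (2 * r : ℤ)] → ∀ k, 1 ≤ k → k ≤ 2 ^ h + 2 →
        ((k * (2 ^ h - 1) : ℕ) : ZMod (2 ^ (2 * h + 1) - 1)) ∈ R) := by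
    have hrun := fun k => mul_mem_weightZeros (k := k) hh hhU
    have hrun2 := fun h' k => mul_mem_weightZeros_of_two_mul_mem (k := k) hh hhU (hU2 h')
    rcases hUS with rfl | rfl
    · exact ⟨T, hT2, hT0, hTneg, by omega, by omega, by omega, hde, rfl, rfl, rfl,
        hrun, hrun2⟩
    · exact ⟨T', hT2', hT0', hTneg', by omega, by omega, by omega, hde', hmin, hmind,
        hmine, hrun, hrun2⟩
  refine ⟨⟨⟨T, T', -1, hsplit, hasDefiningSet_zeroCode ha hodd hT2,
      hasDefiningSet_zeroCode ha hodd hT2'⟩, minDist (zeroCode (α : F) T),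
      ⟨Fintype.card_fin _, hdim, rfl⟩, ⟨Fintype.card_fin _, hdim', hmin⟩, ?_, ?_⟩,
    ⟨⟨T, T', -1, hsplit, ?_, ?_⟩, minDist (dualCode (zeroCode (α : F) T)),
      ⟨Fintype.card_fin _, hdimd, rfl⟩, ⟨Fintype.card_fin _, hdimd', hmind⟩, ?_, ?_⟩,
    ⟨minDist (extendedCode (zeroCode (α : F) T)),
      ⟨by rw [Fintype.card_fin, hsub], hdime, rfl⟩,
      ⟨by rw [Fintype.card_fin, hsub], hdime', hmine⟩, ?_⟩,
    isSelfDual_extendedCode_zeroCode ha hodd hT2 hT0 hTneg,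
    isSelfDual_extendedCode_zeroCode ha hodd hT2' hT0' hTneg', hde, hde'⟩
  · intro h'
    rw [← hRmin]
    exact le_minDist hRdim fun c hc hc0 =>
      lt_hammingNorm_of_mem_zeroCode ha hcop (hrun2 h') hc hc0
  · intro _
    rw [← hRmin]
    exact le_minDist hRdim fun c hc hc0 => lt_hammingNorm_of_mem_zeroCode ha hcop hrun hc hc0
  · rw [dualCode_zeroCode ha hodd hT2 hT0 hTneg, Set.singleton_union, ← Finset.coe_insert]
    exact hasDefiningSet_zeroCode ha hodd (two_mul_mem_insert_zero hT2)
  · rw [dualCode_zeroCode ha hodd hT2' hT0' hTneg', Set.singleton_union, ← Finset.coe_insert]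
    exact hasDefiningSet_zeroCode ha hodd (two_mul_mem_insert_zero hT2')
  · intro h'
    rw [← hRmind]
    refine le_minDist hRdimd fun c hc hc0 => ?_
    rw [dualCode_zeroCode ha hodd hR2 hR0 hRneg] at hc
    exact lt_hammingNorm_of_mem_zeroCode_insert_zero ha hcop (hrun2 h') hc hc0
  · intro _
    rw [← hRmind]
    refine le_minDist hRdimd fun c hc hc0 => ?_
    rw [dualCode_zeroCode ha hodd hR2 hR0 hRneg] at hc
    exact lt_hammingNorm_of_mem_zeroCode_insert_zero ha hcop hrun hc hc0
  · intro h5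
    rw [← hRmine]
    refine le_minDist hRdime fun c hc hc0 => ?_
    have h6 := lt_hammingNorm_of_mem_extendedCode ha hcop hrun hc hc0
    have h7 := hRde c hc
    -- The weight exceeds 2^h and both are multiples of 4, as m ≥ 5 gives h ≥ 2; so it is at least
    -- 2^h + 4.
    have h8 : 4 ∣ 2 ^ h := pow_dvd_pow 2 (show 2 ≤ h by omega)
    omega
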